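/- Let $F$ be a field of characteristic $0$ that is either algebraically closed or real-closed, where $F$ is called real-closed if $F$ is not algebraically closed but $F(\sqrt{-1})$ is algebraically closed. Let $G$ be a locally finite group, i.e. a group in which every finitely generated subgroup is finite. Let $F^\tau G$ be a twisted group algebra of $G$ over $F$, i.e. an associative unital $F$-algebra that has an $F$-basis $\{\bar x : x\in G\}$ indexed by $G$ with multiplication $\bar x\,\bar y=\tau(x,y)\,\overline{xy}$ for all $x,y\in G$, where $\tau:G\times G\to F\setminus\{0\}$. Let $\mathcal U(F^\tau G)$ be its unit group and $\mathcal U(F^\tau G)'$ the subgroup generated by the commutators $aba^{-1}b^{-1}$ with $a,b\in\mathcal U(F^\tau G)$. Then every $u\in\mathcal U(F^\tau G)'$ can be written as $u=v^2w^2$ with $v,w\in\mathcal U(F^\tau G)$. -/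

import Mathlib

/-- A group is locally finite if each of its finitely generated subgroups is finite. -/
def IsLocallyFiniteGroup (G : Type*) [Group G] : Prop :=
  ∀ H : Subgroup G, H.FG → Finite H

/-- A field `F` is real-closed if it is not algebraically closed but `F(√-1)`, the splitting field
of `X² + 1` over `F`, is algebraically closed. -/
def IsRealClosedField (F : Type*) [Field F] : Prop :=
  ¬ IsAlgClosed F ∧
    IsAlgClosed (Polynomial.X ^ 2 + 1 : Polynomial F).SplittingField

/-- The (associative, unital) `F`-algebra `A` is a twisted group algebra `F^τ G` of `G` over `F`
with twisting function `τ : G × G → F \ {0}`: it has an `F`-basis `x ↦ x̄` indexed by `G` such that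
`x̄ ȳ = τ(x, y) (xy)‾`. The identity element need not be `1̄`; by associativity `τ` is
automatically a 2-cocycle. -/
def IsTwistedGroupAlgebra (F G A : Type*) [Field F] [Group G] [Ring A] [Algebra F A]
    (τ : G → G → Fˣ) : Prop :=
  ∃ bar : Module.Basis G F A, ∀ x y : G, bar x * bar y = (τ x y : F) • bar (x * y)

/-! A commutator product involves finitely many basis elements, so local finiteness puts it in the
derived subgroup of the units of the twisted group algebra of a finite subgroup. That algebra is
semisimple (a Maschke argument with the trace of left multiplication), hence a product of matrix
algebras over finite-dimensional division algebras `D` over `F`, and each factor can be treated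
separately.

In any finite-dimensional algebra a unit has the form `u = s * w ^ 2` with `s ^ 2 = 1`: every
element of an algebraic field extension of `F` is a square up to sign, and this lifts from the
residue fields of `F[u]`. It remains to make `s = 1 - 2p`, with `p` idempotent, a square. This works
as soon as `-1` has a square root among the endomorphisms of the range of `p`. Scalars supply one if
`D` contains a root of `-1`. Otherwise `D = F`, and `det u = 1` forces the range to have even
dimension: in odd dimension `(det w) ^ 2 = -1`. -/

open Polynomial

/-! ### Square roots over algebraically closed and real-closed fields -/

/-- Every element of the splitting field of `X² + 1` has the form `a + b i`. -/
theorem exists_sq_eq_neg_one_and_forall_eq_add_mul (F : Type*) [Field F] :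
    ∃ i : (X ^ 2 + 1 : F[X]).SplittingField, i ^ 2 = -1 ∧
      ∀ z, ∃ a b : F, z = algebraMap F _ a + algebraMap F _ b * i := by
  let L := (X ^ 2 + 1 : F[X]).SplittingField
  have hdeg : (X ^ 2 + 1 : F[X]).degree ≠ 0 := by
    rw [show (X ^ 2 + 1 : F[X]).degree = 2 by compute_degree!]
    norm_num
  obtain ⟨i, hi⟩ : ∃ i : L, i ^ 2 = -1 := by
    obtain ⟨i, hi⟩ := (SplittingField.splits (X ^ 2 + 1 : F[X])).exists_eval_eq_zero
      (by rwa [degree_map])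
    exact ⟨i, eq_neg_of_add_eq_zero_left (by simpa using hi)⟩
  have htop : Algebra.adjoin F {i} = (⊤ : Subalgebra F L) := by
    rw [eq_top_iff, ← SplittingField.adjoin_rootSet, Algebra.adjoin_le_iff]
    intro z hz
    have hz' : z ^ 2 + 1 = 0 := by simpa using (mem_rootSet'.1 hz).2
    have : (z - i) * (z + i) = 0 := by linear_combination hz' - hi
    have hmem : i ∈ Algebra.adjoin F {i} := Algebra.self_mem_adjoin_singleton F i
    rcases mul_eq_zero.1 this with h | h
    · rw [sub_eq_zero.1 h]; exact hmem
    · rw [eq_neg_of_add_eq_zero_left h]; exact neg_mem hmem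
  refine ⟨i, hi, fun z => ?_⟩
  have hz : z ∈ Algebra.adjoin F {i} := htop ▸ Algebra.mem_top
  induction hz using Algebra.adjoin_induction with
  | mem x hx => exact ⟨0, 1, by simpa using hx⟩
  | algebraMap r => exact ⟨r, 0, by simp⟩
  | add x y _ _ hx hy =>
    obtain ⟨a, b, rfl⟩ := hx
    obtain ⟨c, d, rfl⟩ := hy
    exact ⟨a + c, b + d, by simp only [map_add]; ring⟩
  | mul x y _ _ hx hy =>
    obtain ⟨a, b, rfl⟩ := hx
    obtain ⟨c, d, rfl⟩ := hy
    refine ⟨a * c - b * d, a * d + b * c, ?_⟩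
    simp only [map_add, map_sub, map_mul]
    linear_combination (algebraMap F L b * algebraMap F L d) * hi

/-- A proper algebraic extension field of a real-closed field is quadratically closed. -/
theorem IsRealClosedField.surjective_or_forall_isSquare {F K : Type*} [Field F]
    (hF : IsRealClosedField F) [Field K] [Algebra F K] [Algebra.IsAlgebraic F K] :
    Function.Surjective (algebraMap F K) ∨ ∀ x : K, ∃ w, x = w ^ 2 := by
  have := hF.2
  obtain ⟨i, hi, hform⟩ := exists_sq_eq_neg_one_and_forall_eq_add_mul F
  let L := (X ^ 2 + 1 : F[X]).SplittingField
  let φ : K →ₐ[F] L := IsAlgClosed.lift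
  by_cases hr : ∃ y, φ y = i
  · right
    obtain ⟨y, hy⟩ := hr
    intro x
    obtain ⟨z, hz⟩ := IsAlgClosed.exists_pow_nat_eq (φ x) (n := 2) (by norm_num)
    obtain ⟨a, b, hab⟩ := hform z
    -- Once `i` lies in the image of `φ`, the image is all of `L`, so square roots taken in `L` pull
    -- back to `K`.
    refine ⟨algebraMap F K a + algebraMap F K b * y, φ.injective ?_⟩
    change φ _ = φ _
    simp only [map_pow, map_add, map_mul, AlgHom.commutes, hy]
    exact hz.symm.trans (by rw [hab])
  · left
    intro x
    obtain ⟨a, b, hab⟩ := hform (φ x)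
    by_cases hb : b = 0
    · refine ⟨a, φ.injective ?_⟩
      change φ _ = φ _
      rw [hab, hb, AlgHom.commutes, map_zero, zero_mul, add_zero]
    -- With `b ≠ 0`, solving `φ x = a + b * i` for `i` would put `i` in the image of `φ`.
    · refine absurd ⟨algebraMap F K b⁻¹ * (x - algebraMap F K a), ?_⟩ hr
      have hb' : algebraMap F L b⁻¹ * algebraMap F L b = 1 := by
        rw [← map_mul, inv_mul_cancel₀ hb, map_one]
      simp only [map_mul, map_sub, AlgHom.commutes, hab]
      linear_combination i * hb'

/-- Elements of a real-closed field are squares up to sign. -/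
theorem IsRealClosedField.exists_eq_sq_or_neg_sq {F : Type*} [Field F] [CharZero F]
    (hF : IsRealClosedField F) (a : F) : ∃ w : F, a = w ^ 2 ∨ a = -w ^ 2 := by
  have := hF.2
  obtain ⟨i, hi, hform⟩ := exists_sq_eq_neg_one_and_forall_eq_add_mul F
  let L := (X ^ 2 + 1 : F[X]).SplittingField
  have hinj : Function.Injective (algebraMap F L) := (algebraMap F L).injective
  obtain ⟨z, hz⟩ := IsAlgClosed.exists_pow_nat_eq (algebraMap F L a) (n := 2) (by norm_num)
  obtain ⟨x, y, rfl⟩ := hform z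
  -- Expansion of `(x + y * i) ^ 2 = a`: either `x * y = 0`, or `i` already lies in `F`.
  have key : algebraMap F L (2 * x * y) * i = algebraMap F L (a - x ^ 2 + y ^ 2) := by
    simp only [map_add, map_mul, map_sub, map_pow, map_ofNat]
    linear_combination hz - algebraMap F L y ^ 2 * hi
  by_cases hxy : 2 * x * y = 0
  · have ha : a - x ^ 2 + y ^ 2 = 0 := hinj (by rw [← key, hxy]; simp)
    have hor : x = 0 ∨ y = 0 := by simpa using hxy
    rcases hor with rfl | rfl
    · exact ⟨y, .inr (by linear_combination ha)⟩
    · exact ⟨x, .inl (by linear_combination ha)⟩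
  · obtain ⟨r, hr⟩ : ∃ r : F, algebraMap F L r = i := by
      refine ⟨(2 * x * y)⁻¹ * (a - x ^ 2 + y ^ 2), ?_⟩
      rw [map_mul, ← key, ← mul_assoc, ← map_mul, inv_mul_cancel₀ hxy, map_one, one_mul]
    refine ⟨x + y * r, .inl (hinj ?_)⟩
    rw [← hz, map_pow, map_add, map_mul, hr]

/-- Elements of an algebraic extension of an algebraically closed or real-closed field are
squares up to sign. -/
theorem exists_eq_sq_or_neg_sq {F K : Type*} [Field F] [CharZero F]
    (hF : IsAlgClosed F ∨ IsRealClosedField F) [Field K] [Algebra F K] [Algebra.IsAlgebraic F K]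
    (x : K) : ∃ w : K, x = w ^ 2 ∨ x = -w ^ 2 := by
  rcases hF with hF | hF
  · obtain ⟨a, rfl⟩ := (IsAlgClosed.algebraMap_bijective_of_isIntegral (k := F) (K := K)).2 x
    obtain ⟨w, hw⟩ := IsAlgClosed.exists_pow_nat_eq a (n := 2) (by norm_num)
    exact ⟨algebraMap F K w, .inl (by rw [← map_pow, hw])⟩
  rcases hF.surjective_or_forall_isSquare (K := K) with h | h
  · obtain ⟨a, rfl⟩ := h x
    obtain ⟨w, hw⟩ := hF.exists_eq_sq_or_neg_sq a
    exact ⟨algebraMap F K w, hw.imp (by rintro rfl; simp) (by rintro rfl; simp)⟩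
  · exact (h x).imp fun _ => .inl

/-- A finite-dimensional division algebra over an algebraically closed or real-closed field either
contains a square root of `-1` or is one-dimensional. -/
theorem exists_mul_self_eq_neg_one_or_surjective {F D : Type*} [Field F]
    (hF : IsAlgClosed F ∨ IsRealClosedField F) [DivisionRing D] [Algebra F D] [Module.Finite F D] :
    (∃ j : D, j * j = -1) ∨ Function.Surjective (algebraMap F D) := by
  rcases hF with hF | hF
  · obtain ⟨j, hj⟩ := IsAlgClosed.exists_pow_nat_eq (-1 : F) (n := 2) (by norm_num)
    exact .inl ⟨algebraMap F D j, by rw [← map_mul, ← sq, hj]; simp⟩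
  rw [or_iff_not_imp_right, Function.Surjective, not_forall]
  rintro ⟨d, hd⟩
  let K := Algebra.adjoin F {d}
  have : IsMulCommutative K := Algebra.isMulCommutative_adjoin F (by simp)
  let : CommRing K := inferInstance
  have : IsDomain K := inferInstanceAs (IsDomain (Algebra.adjoin F {d}))
  have hfin : Module.Finite F K := inferInstance
  let : Field K := fieldOfFiniteDimensional F K
  rcases hF.surjective_or_forall_isSquare (K := K) with h | h
  · obtain ⟨a, ha⟩ := h ⟨d, Algebra.self_mem_adjoin_singleton F d⟩
    exact absurd ⟨a, congrArg Subtype.val ha⟩ hd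
  · obtain ⟨w, hw⟩ := h (-1)
    exact ⟨w, by simpa [sq] using (congrArg Subtype.val hw).symm⟩

/-! ### Units as involutions times squares -/

/-- In a finite-dimensional commutative algebra over an algebraically closed or real-closed field,
a unit is a square up to a factor of square `1`. -/
theorem exists_sq_eq_one_and_eq_mul_sq {F R : Type*} [Field F] [CharZero F]
    (hF : IsAlgClosed F ∨ IsRealClosedField F) [CommRing R] [Algebra F R] [Module.Finite F R]
    (u : Rˣ) : ∃ s w : R, s ^ 2 = 1 ∧ (u : R) = s * w ^ 2 := by
  have : IsArtinianRing R := IsArtinianRing.of_finite F R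
  have h2 : IsUnit (2 : R) := by
    simpa only [map_ofNat] using (IsUnit.mk0 (2 : F) two_ne_zero).map (algebraMap F R)
  have hfield (I : MaximalSpectrum R) : ∃ s w : R ⧸ I.asIdeal,
      s ^ 2 = 1 ∧ Ideal.Quotient.mk I.asIdeal u = s * w ^ 2 := by
    let := Ideal.Quotient.field I.asIdeal
    obtain ⟨w, hw | hw⟩ := exists_eq_sq_or_neg_sq hF (Ideal.Quotient.mk I.asIdeal (u : R))
    · exact ⟨1, w, by simp, by rw [hw, one_mul]⟩
    · exact ⟨-1, w, by simp, by rw [hw, neg_one_mul]⟩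
  choose s w hs hw using hfield
  -- Modulo its nilradical `R` is the product of its residue fields, so the local choices assemble
  -- to `s₀` and `w₀`, correct up to nilpotents.
  let e := IsArtinianRing.quotNilradicalEquivPi R
  obtain ⟨s₀, hs₀⟩ := Ideal.Quotient.mk_surjective (e.symm s)
  obtain ⟨w₀, hw₀⟩ := Ideal.Quotient.mk_surjective (e.symm w)
  have nil_s : IsNilpotent (s₀ ^ 2 - 1) := by
    rw [← mem_nilradical, ← Ideal.Quotient.eq, map_pow, hs₀, ← map_pow, map_one]
    rw [show s ^ 2 = 1 from funext hs, map_one]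
  have nil_w : IsNilpotent (s₀ * w₀ ^ 2 - u) := by
    rw [← mem_nilradical, ← Ideal.Quotient.eq, map_mul, map_pow, hs₀, hw₀, ← map_pow, ← map_mul]
    rw [show s * w ^ 2 = e (Ideal.Quotient.mk _ (u : R)) from funext fun I => (hw I).symm]
    simp
  have unit_of_sq {a b : R} (hb : IsUnit b) (h : IsNilpotent (a ^ 2 - b)) : IsUnit a := by
    have : IsUnit (a ^ 2) := by
      simpa using (h.isUnit_add_left_of_commute hb (Commute.all _ _))
    exact (isUnit_pow_iff two_ne_zero).1 this
  -- Newton iteration for `X ^ 2 - b`: the derivative `2 * a` is a unit, so an approximate root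
  -- modulo nilpotents becomes exact.
  have lift_sq {a b : R} (hb : IsUnit b) (h : IsNilpotent (a ^ 2 - b)) :
      ∃ c, IsNilpotent (a - c) ∧ c ^ 2 = b := by
    obtain ⟨c, ⟨hc, hc'⟩, -⟩ := existsUnique_nilpotent_sub_and_aeval_eq_zero
      (P := X ^ 2 - C b) (x := a) (by simpa using h)
      (by simpa [one_add_one_eq_two] using h2.mul (unit_of_sq hb h))
    exact ⟨c, hc, by simpa [sub_eq_zero] using hc'⟩
  obtain ⟨s₁, hn₁, hs₁⟩ := lift_sq isUnit_one nil_s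
  -- Since `s₁` is its own inverse, the equation left to solve is `w ^ 2 = s₁ * u`.
  have nil : IsNilpotent (w₀ ^ 2 - s₁ * u) := by
    have : w₀ ^ 2 - s₁ * u = s₁ * (s₀ * w₀ ^ 2 - u) - s₁ * w₀ ^ 2 * (s₀ - s₁) := by
      linear_combination -w₀ ^ 2 * hs₁
    rw [this]
    exact (Commute.all _ _).isNilpotent_sub ((Commute.all _ _).isNilpotent_mul_left nil_w)
      ((Commute.all _ _).isNilpotent_mul_left hn₁)
  have hs_unit : IsUnit s₁ := IsUnit.of_mul_eq_one s₁ (by rw [← sq, hs₁])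
  obtain ⟨w₁, -, hw₁⟩ := lift_sq (hs_unit.mul u.isUnit) nil
  exact ⟨s₁, w₁, hs₁, by rw [hw₁, ← mul_assoc, ← sq, hs₁, one_mul]⟩

/-- In a finite-dimensional algebra over an algebraically closed or real-closed field, a unit is
the product of an element of square `1` and a square. -/
theorem Units.exists_sq_eq_one_and_eq_mul_sq {F R : Type*} [Field F] [CharZero F]
    (hF : IsAlgClosed F ∨ IsRealClosedField F) [Ring R] [Algebra F R] [Module.Finite F R]
    (u : Rˣ) : ∃ s w : Rˣ, s ^ 2 = 1 ∧ u = s * w ^ 2 := by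
  let K := Algebra.adjoin F {(u : R)}
  have : IsMulCommutative K := Algebra.isMulCommutative_adjoin F (by simp)
  let : CommRing K := inferInstance
  have hfin : Module.Finite F K := inferInstance
  have hu : IsUnit (⟨u, Algebra.self_mem_adjoin_singleton F (u : R)⟩ : K) := by
    have : IsArtinianRing K := IsArtinianRing.of_finite F K
    refine IsArtinianRing.isUnit_of_mem_nonZeroDivisors ?_
    rw [mem_nonZeroDivisors_iff_right]
    intro x hx
    have := congrArg Subtype.val hx
    exact Subtype.ext ((Units.mul_left_eq_zero u).1 this)
  obtain ⟨s, w, hs, hw⟩ := _root_.exists_sq_eq_one_and_eq_mul_sq hF hu.unit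
  have hs' : IsUnit s := IsUnit.of_mul_eq_one s (by rw [← sq, hs])
  have hw' : IsUnit w := by
    have : IsUnit (s * w ^ 2) := hw ▸ hu.unit.isUnit
    exact (isUnit_pow_iff two_ne_zero).1 (isUnit_of_mul_isUnit_right this)
  refine ⟨Units.map (Subalgebra.val K : K →* R) hs'.unit,
    Units.map (Subalgebra.val K : K →* R) hw'.unit, ?_, ?_⟩
  · ext; exact congrArg Subtype.val hs
  · ext; exact congrArg Subtype.val hw

/-! ### Square roots of involutions -/

/-- If the range of an idempotent endomorphism `p` has an endomorphism of square `-1`, then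
`1 - 2p` is a square. -/
theorem LinearMap.exists_sq_eq_one_sub_two_mul {D V : Type*} [Ring D] [AddCommGroup V] [Module D V]
    {p : Module.End D V} (hp : IsIdempotentElem p)
    (J : Module.End D (LinearMap.range p)) (hJ : J * J = -1) :
    ∃ v : Module.End D V, v * v = 1 - 2 * p := by
  let q : V →ₗ[D] LinearMap.range p := p.rangeRestrict
  have hpp (x : V) : p (p x) = p x := LinearMap.congr_fun hp x
  have hq (y : LinearMap.range p) : q y = y := by
    obtain ⟨_, x, rfl⟩ := y
    exact Subtype.ext (hpp x)
  have hpv (y : LinearMap.range p) : p y = y := congrArg Subtype.val (hq y)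
  have hqp (x : V) : q (p x) = q x := Subtype.ext (hpp x)
  have hJJ (y : LinearMap.range p) : J (J y) = -y := LinearMap.congr_fun hJ y
  -- The root is `J` on the range of `p` and the identity on its kernel.
  refine ⟨(LinearMap.range p).subtype ∘ₗ J ∘ₗ q + (1 - p), LinearMap.ext fun x => ?_⟩
  have hqx : ((q x : LinearMap.range p) : V) = p x := rfl
  simp only [Module.End.mul_apply, LinearMap.add_apply, LinearMap.sub_apply, Module.End.one_apply,
    LinearMap.comp_apply, Submodule.subtype_apply, map_add, map_sub, hq, hqp, hJJ, hpv, hpp,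
    two_mul, NegMemClass.coe_neg, hqx]
  abel_nf

/-- An endomorphism of square `-1` of a vector space over a division ring with a square root
of `-1`. -/
theorem Module.End.exists_mul_self_eq_neg_one_of_scalar {D W : Type*} [DivisionRing D]
    [AddCommGroup W] [Module D W] {j : D} (hj : j * j = -1) : ∃ J : Module.End D W, J * J = -1 := by
  let b := Module.Basis.ofVectorSpace D W
  refine ⟨b.constr ℕ fun i => j • b i, b.ext fun i => ?_⟩
  simp [smul_smul, hj]

/-- An endomorphism of square `-1` of a vector space of even dimension. -/
theorem Module.End.exists_mul_self_eq_neg_one_of_even {F W : Type*} [Field F]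
    [AddCommGroup W] [Module F W] [Module.Finite F W] (h : Even (Module.finrank F W)) :
    ∃ J : Module.End F W, J * J = -1 := by
  obtain ⟨m, hm⟩ := h
  let e : W ≃ₗ[F] (Fin m → F) × (Fin m → F) := LinearEquiv.ofFinrankEq _ _ (by simp [hm])
  let J : Module.End F ((Fin m → F) × (Fin m → F)) :=
    (-LinearMap.snd F _ _).prod (LinearMap.fst F _ _)
  refine ⟨e.symm ∘ₗ J ∘ₗ e, LinearMap.ext fun x => e.injective ?_⟩
  simp only [Module.End.mul_apply, LinearMap.comp_apply, LinearEquiv.coe_coe,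
    LinearEquiv.apply_symm_apply, LinearMap.neg_apply, Module.End.one_apply, map_neg]
  ext <;> simp [J]

theorem LinearMap.det_one_sub_two_mul {F V : Type*} [Field F] [AddCommGroup V] [Module F V]
    [Module.Finite F V] {p : Module.End F V} (hp : IsIdempotentElem p) :
    LinearMap.det (1 - 2 * p) = (-1) ^ Module.finrank F (LinearMap.range p) := by
  let e := Submodule.prodEquivOfIsCompl _ _ (LinearMap.IsIdempotentElem.isCompl hp)
  have hpp (x : V) : p (p x) = p x := LinearMap.congr_fun hp x
  -- In the decomposition of `V` as range plus kernel of `p`, the map is `-1` on the first summand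
  -- and `1` on the second.
  have : (1 - 2 * p : Module.End F V) = (e : _ →ₗ[F] V) ∘ₗ
      LinearMap.prodMap (-1 : Module.End F (LinearMap.range p)) (1 : Module.End F (LinearMap.ker p))
      ∘ₗ (e.symm : V →ₗ[F] _) := by
    refine LinearMap.ext fun x => ?_
    obtain ⟨⟨⟨_, y, rfl⟩, ⟨z, hz⟩⟩, rfl⟩ := e.surjective x
    have hz : p z = 0 := hz
    simp only [LinearMap.comp_apply, LinearEquiv.coe_coe, LinearEquiv.symm_apply_apply]
    simp [e, Submodule.coe_prodEquivOfIsCompl', two_mul, hpp, hz]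
    abel_nf
  rw [this, LinearMap.det_conj, LinearMap.det_prodMap]
  rw [show (-1 : Module.End F (LinearMap.range p)) = (-1 : F) • LinearMap.id by ext; simp,
    LinearMap.det_smul]
  simp

/-- In characteristic not two, an element of square `1` is `1 - 2p` for an idempotent `p`. -/
theorem exists_isIdempotentElem_eq_one_sub_two_mul {R : Type*} [Ring R] [Invertible (2 : R)] {s : R}
    (hs : s ^ 2 = 1) : ∃ p : R, IsIdempotentElem p ∧ s = 1 - 2 * p := by
  have hc (x : R) : ⅟(2 : R) * x = x * ⅟2 :=
    (Commute.ofNat_left 2 x).symm.invOf_right.symm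
  refine ⟨⅟2 * (1 - s), ?_, by simp⟩
  have h : (1 - s) * (1 - s) = 2 * (1 - s) := by
    rw [sq] at hs
    rw [mul_sub, sub_mul, sub_mul, hs]
    noncomm_ring
  rw [IsIdempotentElem, mul_assoc, ← mul_assoc (1 - s), ← hc, mul_assoc, h, invOf_mul_cancel_left]

/-! ### Matrix algebras and semisimple algebras -/

/-- Every element of the derived subgroup of the unit group is a product of two squares. -/
def CommutatorsAreTwoSquares (R : Type*) [Monoid R] : Prop :=
  ∀ u ∈ commutator Rˣ, ∃ v w : Rˣ, u = v ^ 2 * w ^ 2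

theorem map_mem_commutator {G H : Type*} [Group G] [Group H] (f : G →* H) {g : G}
    (hg : g ∈ commutator G) : f g ∈ commutator H := by
  have : Subgroup.map f (commutator G) ≤ commutator H := by
    rw [commutator_def, Subgroup.map_commutator]
    exact Subgroup.commutator_mono le_top le_top
  exact this (Subgroup.mem_map_of_mem f hg)

theorem CommutatorsAreTwoSquares.of_mulEquiv {R S : Type*} [Monoid R] [Monoid S] (e : R ≃* S)
    (h : CommutatorsAreTwoSquares S) : CommutatorsAreTwoSquares R := by
  intro u hu
  obtain ⟨v, w, hvw⟩ := h _ (map_mem_commutator (Units.mapEquiv e).toMonoidHom hu)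
  refine ⟨(Units.mapEquiv e).symm v, (Units.mapEquiv e).symm w, (Units.mapEquiv e).injective ?_⟩
  rw [map_mul, map_pow, map_pow, MulEquiv.apply_symm_apply, MulEquiv.apply_symm_apply]
  exact hvw

theorem CommutatorsAreTwoSquares.pi {ι : Type*} {R : ι → Type*} [∀ i, Monoid (R i)]
    (h : ∀ i, CommutatorsAreTwoSquares (R i)) : CommutatorsAreTwoSquares (∀ i, R i) := by
  intro u hu
  choose v w hvw using fun i =>
    h i _ (map_mem_commutator (Units.map (Pi.evalMonoidHom R i)) hu)
  refine ⟨MulEquiv.piUnits.symm v, MulEquiv.piUnits.symm w, MulEquiv.piUnits.injective ?_⟩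
  rw [map_mul, map_pow, map_pow, MulEquiv.apply_symm_apply, MulEquiv.apply_symm_apply]
  exact funext hvw

/-- It suffices to extract square roots of the involutions that are square multiples of
elements of the derived subgroup. -/
theorem CommutatorsAreTwoSquares.of_forall_involution {F R : Type*} [Field F] [CharZero F]
    (hF : IsAlgClosed F ∨ IsRealClosedField F) [Ring R] [Algebra F R] [Module.Finite F R]
    (h : ∀ u ∈ commutator Rˣ, ∀ s w : Rˣ, s ^ 2 = 1 → u = s * w ^ 2 → ∃ v : R, v * v = s) :
    CommutatorsAreTwoSquares R := by
  intro u hu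
  obtain ⟨s, w, hs, hw⟩ := u.exists_sq_eq_one_and_eq_mul_sq hF
  obtain ⟨v, hv⟩ := h u hu s w hs hw
  have hv' : IsUnit v := (isUnit_pow_iff two_ne_zero).1 (by rw [sq, hv]; exact s.isUnit)
  refine ⟨hv'.unit, w, ?_⟩
  rw [hw, show hv'.unit ^ 2 = s from Units.ext (by simpa [sq] using hv)]

theorem CommutatorsAreTwoSquares.matrix_field {F : Type*} [Field F] [CharZero F]
    (hF : IsAlgClosed F ∨ IsRealClosedField F) (hj : ¬ ∃ j : F, j * j = -1) (n : ℕ) :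
    CommutatorsAreTwoSquares (Matrix (Fin n) (Fin n) F) := by
  refine .of_mulEquiv (Matrix.toLinAlgEquiv' : _ ≃ₐ[F] Module.End F (Fin n → F)).toMulEquiv ?_
  refine .of_forall_involution hF fun u hu s w hs hw => ?_
  have : Invertible (2 : Module.End F (Fin n → F)) :=
    (Invertible.map (algebraMap F _) (2 : F)).copy _ (map_ofNat _ 2).symm
  obtain ⟨p, hp, hsp⟩ := exists_isIdempotentElem_eq_one_sub_two_mul
    (show (s : Module.End F (Fin n → F)) ^ 2 = 1 from congrArg Units.val hs)
  rw [hsp]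
  have hdet : LinearMap.det (u : Module.End F (Fin n → F)) = 1 := by
    have := Abelianization.commutator_subset_ker
      (Units.map (LinearMap.det : Module.End F (Fin n → F) →* F)) hu
    exact congrArg Units.val this
  obtain ⟨J, hJ⟩ := Module.End.exists_mul_self_eq_neg_one_of_even (F := F)
    (W := LinearMap.range p) <| by
    -- If the rank is odd then `det s = -1`, so `1 = det u = -(det w) ^ 2` and `det w` is a root of
    -- `-1` in `F`.
    by_contra hodd
    refine hj ⟨LinearMap.det (w : Module.End F (Fin n → F)), ?_⟩
    rw [hw, Units.val_mul, hsp, map_mul, LinearMap.det_one_sub_two_mul hp,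
      (Nat.not_even_iff_odd.1 hodd).neg_one_pow, Units.val_pow_eq_pow_val, map_pow] at hdet
    linear_combination -hdet
  exact LinearMap.exists_sq_eq_one_sub_two_mul hp J hJ

theorem CommutatorsAreTwoSquares.matrix {F D : Type*} [Field F] [CharZero F]
    (hF : IsAlgClosed F ∨ IsRealClosedField F) [DivisionRing D] [Algebra F D] [Module.Finite F D]
    (n : ℕ) : CommutatorsAreTwoSquares (Matrix (Fin n) (Fin n) D) := by
  by_cases hj : ∃ j : D, j * j = -1
  · obtain ⟨j, hj⟩ := hj
    refine .of_forall_involution hF fun u hu s w hs hw => ?_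
    have : Invertible (2 : Matrix (Fin n) (Fin n) D) :=
      (Invertible.map (algebraMap F _) (2 : F)).copy _ (map_ofNat _ 2).symm
    obtain ⟨p, hp, hsp⟩ := exists_isIdempotentElem_eq_one_sub_two_mul
      (show (s : Matrix (Fin n) (Fin n) D) ^ 2 = 1 from congrArg Units.val hs)
    rw [hsp]
    -- Matrices act on row vectors, since `D` may be noncommutative. This reverses products, which
    -- is harmless because only products of an element with itself occur.
    have hp' : IsIdempotentElem (p.toLinearMapRight' : Module.End D (Fin n → D)) := by
      rw [IsIdempotentElem, Module.End.mul_eq_comp, ← Matrix.toLinearMapRight'_mul, hp]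
    obtain ⟨J, hJ⟩ := Module.End.exists_mul_self_eq_neg_one_of_scalar
      (W := LinearMap.range p.toLinearMapRight') hj
    obtain ⟨v, hv⟩ := LinearMap.exists_sq_eq_one_sub_two_mul hp' J hJ
    refine ⟨LinearMap.toMatrixRight' v, Matrix.toLinearMapRight'.injective ?_⟩
    rw [Matrix.toLinearMapRight'_mul, LinearEquiv.symm_apply_apply]
    refine hv.trans ?_
    rw [two_mul, two_mul, map_sub, map_add, Matrix.toLinearMapRight'_one]
    rfl
  · have hs := (exists_mul_self_eq_neg_one_or_surjective hF).resolve_left hj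
    let e : F ≃ₐ[F] D := AlgEquiv.ofBijective (Algebra.ofId F D) ⟨(algebraMap F D).injective, hs⟩
    refine .of_mulEquiv (e.symm.mapMatrix (m := Fin n)).toMulEquiv (.matrix_field hF ?_ n)
    rintro ⟨j, hj'⟩
    exact hj ⟨algebraMap F D j, by rw [← map_mul, hj', map_neg, map_one]⟩

theorem CommutatorsAreTwoSquares.of_isSemisimpleRing {F R : Type*} [Field F] [CharZero F]
    (hF : IsAlgClosed F ∨ IsRealClosedField F) [Ring R] [Algebra F R] [Module.Finite F R]
    [IsSemisimpleRing R] : CommutatorsAreTwoSquares R := by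
  obtain ⟨n, D, d, _, _, _, _, ⟨e⟩⟩ :=
    IsSemisimpleRing.exists_algEquiv_pi_matrix_divisionRing_finite F R
  exact .of_mulEquiv e.toMulEquiv (.pi fun i => .matrix hF (d i))

/-! ### Twisted group algebras: semisimplicity and reduction to finite subgroups -/

theorem Ring.isNilpotent_of_mem_jacobson {R : Type*} [Ring R] [IsArtinianRing R] {x : R}
    (hx : x ∈ Ring.jacobson R) : IsNilpotent x := by
  obtain ⟨n, hn⟩ := IsSemiprimaryRing.isNilpotent (R := R)
  exact ⟨n, by simpa [hn] using Ideal.pow_mem_pow hx n⟩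

section TwistedBasis

variable {F G A : Type*} [Field F] [Group G] [Ring A] [Algebra F A] {τ : G → G → Fˣ}
  {bar : Module.Basis G F A}

theorem twistedBasis_repr_mul (hbar : ∀ x y : G, bar x * bar y = (τ x y : F) • bar (x * y))
    (a : A) (g k : G) : bar.repr (a * bar k) (g * k) = bar.repr a g * τ g k := by
  classical
  have : bar.coord (g * k) ∘ₗ LinearMap.mulRight F (bar k) = (τ g k : F) • bar.coord g := by
    refine bar.ext fun x => ?_
    by_cases hx : x = g
    · subst hx; simp [hbar]
    · simp [hbar, hx]
  simpa [mul_comm] using LinearMap.congr_fun this a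

/-- The identity is a multiple of `bar 1`, so it lies in the span of the basis elements of any
subgroup. -/
theorem twistedBasis_repr_one (hbar : ∀ x y : G, bar x * bar y = (τ x y : F) • bar (x * y))
    {g : G} (hg : g ≠ 1) : bar.repr 1 g = 0 := by
  simpa [Finsupp.single_apply, hg.symm] using twistedBasis_repr_mul hbar 1 g 1

/-- Associativity of `bar 1 * bar 1 * bar k`. This makes the diagonal entries of a left
multiplication all equal. -/
theorem twistedBasis_cocycle_one_left
    (hbar : ∀ x y : G, bar x * bar y = (τ x y : F) • bar (x * y)) (k : G) :
    (τ 1 k : F) = τ 1 1 := by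
  have h := congrArg (bar.repr · k) (mul_assoc (bar 1) (bar 1) (bar k))
  have h' : (τ 1 1 : F) * τ 1 k = τ 1 k * τ 1 k := by
    simpa [hbar, smul_smul, mul_smul_comm, smul_mul_assoc] using h
  exact (mul_right_cancel₀ (τ 1 k).ne_zero h').symm

/-- Twisted group algebras of finite groups in characteristic zero are semisimple. -/
theorem IsTwistedGroupAlgebra.isSemisimpleRing [CharZero F] [Finite G]
    (hA : IsTwistedGroupAlgebra F G A τ) : IsSemisimpleRing A := by
  classical
  obtain ⟨bar, hbar⟩ := hA
  have := Fintype.ofFinite G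
  have hfin : Module.Finite F A := .of_basis bar
  have : IsArtinianRing A := IsArtinianRing.of_finite F A
  rw [IsArtinianRing.isSemisimpleRing_iff_jacobson, eq_bot_iff]
  intro x hx
  -- Only the coefficient of `a` at `1` contributes to the diagonal, and it contributes equally at
  -- each of the `|G|` places.
  have htr (a : A) : LinearMap.trace F A (LinearMap.mulLeft F a) =
      Fintype.card G * (bar.repr a 1 * τ 1 1) := by
    rw [LinearMap.trace_eq_matrix_trace F bar, Matrix.trace]
    have (k : G) : (LinearMap.toMatrix bar bar (LinearMap.mulLeft F a)).diag k =
        bar.repr a 1 * τ 1 1 := by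
      rw [Matrix.diag_apply, LinearMap.toMatrix_apply, LinearMap.mulLeft_apply,
        ← twistedBasis_cocycle_one_left hbar k, ← twistedBasis_repr_mul hbar, one_mul]
    rw [Finset.sum_congr rfl fun k _ => this k]
    simp
  refine (Submodule.mem_bot A).2 (bar.repr.map_eq_zero_iff.1 (Finsupp.ext fun g => ?_))
  -- Right multiplication by `bar g⁻¹` moves the coefficient of `x` at `g` to `1`, up to a nonzero
  -- factor. The trace then detects it, as `|G|` is nonzero in characteristic zero.
  have hnil : IsNilpotent (x * bar g⁻¹) :=
    Ring.isNilpotent_of_mem_jacobson (Ideal.mul_mem_right _ _ hx)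
  have h0 : LinearMap.trace F A (LinearMap.mulLeft F (x * bar g⁻¹)) = 0 :=
    (LinearMap.isNilpotent_trace_of_isNilpotent (hnil.map (Algebra.lmul F A))).eq_zero
  rw [htr, ← mul_inv_cancel g, twistedBasis_repr_mul hbar] at h0
  simpa using h0

/-- The subalgebra of a twisted group algebra spanned by the basis elements of a subgroup. -/
def twistedSubalgebra (hbar : ∀ x y : G, bar x * bar y = (τ x y : F) • bar (x * y))
    (H : Subgroup G) : Subalgebra F A :=
  (Submodule.span F (bar '' H)).toSubalgebra
    (by
      rw [Module.Basis.mem_span_image]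
      intro g hg
      by_contra hgH
      refine Finsupp.mem_support_iff.1 hg (twistedBasis_repr_one hbar ?_)
      rintro rfl
      exact hgH H.one_mem)
    (by
      intro x y hx hy
      refine (?_ : Submodule.span F (bar '' (H : Set G)) * Submodule.span F (bar '' (H : Set G)) ≤ _)
        (Submodule.mul_mem_mul hx hy)
      rw [Submodule.span_mul_span, Submodule.span_le]
      rintro _ ⟨_, ⟨g, hg, rfl⟩, _, ⟨k, hk, rfl⟩, rfl⟩
      change bar g * bar k ∈ _
      rw [hbar]
      exact Submodule.smul_mem _ _ (Submodule.subset_span ⟨_, H.mul_mem hg hk, rfl⟩))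

variable (hbar : ∀ x y : G, bar x * bar y = (τ x y : F) • bar (x * y))

theorem mem_twistedSubalgebra {H : Subgroup G} {a : A} :
    a ∈ twistedSubalgebra hbar H ↔ ((bar.repr a).support : Set G) ⊆ H :=
  Module.Basis.mem_span_image bar

theorem twistedSubalgebra_mono {H K : Subgroup G} (h : H ≤ K) :
    twistedSubalgebra hbar H ≤ twistedSubalgebra hbar K := fun _ ha =>
  (mem_twistedSubalgebra hbar).2 (((mem_twistedSubalgebra hbar).1 ha).trans h)

theorem isTwistedGroupAlgebra_twistedSubalgebra (H : Subgroup G) :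
    IsTwistedGroupAlgebra F H (twistedSubalgebra hbar H) fun x y => τ x y := by
  have hmem (h : H) : bar h ∈ twistedSubalgebra hbar H :=
    Submodule.subset_span ⟨h, h.2, rfl⟩
  let v : H → twistedSubalgebra hbar H := fun h => ⟨bar h, hmem h⟩
  have hli : LinearIndependent F v :=
    .of_comp (twistedSubalgebra hbar H).val.toLinearMap
      (bar.linearIndependent.comp _ Subtype.val_injective)
  have hsp : ⊤ ≤ Submodule.span F (Set.range v) := by
    rintro ⟨a, ha⟩ -
    have hmap : Submodule.map (twistedSubalgebra hbar H).val.toLinearMap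
        (Submodule.span F (Set.range v)) = Submodule.span F (bar '' H) := by
      rw [Submodule.map_span, ← Set.range_comp]
      congr 1
      ext x
      simp [v]
    obtain ⟨b, hb, hba⟩ := hmap.ge ha
    rwa [show b = ⟨a, ha⟩ from Subtype.ext hba] at hb
  refine ⟨Module.Basis.mk hli hsp, fun x y => ?_⟩
  simp only [Module.Basis.mk_apply]
  exact Subtype.ext (hbar x y)

/-- The unit group of a subalgebra inside the unit group of the algebra. -/
abbrev Subalgebra.unitsVal (S : Subalgebra F A) : Sˣ →* Aˣ :=
  Units.map (S.val : S →* A)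

open scoped commutatorElement in
theorem exists_fg_mem_map_commutator {u : Aˣ} (hu : u ∈ commutator Aˣ) :
    ∃ H : Subgroup G, H.FG ∧
      u ∈ (commutator (twistedSubalgebra hbar H)ˣ).map (twistedSubalgebra hbar H).unitsVal := by
  classical
  have mono {H K : Subgroup G} (h : H ≤ K) :
      (commutator (twistedSubalgebra hbar H)ˣ).map (twistedSubalgebra hbar H).unitsVal ≤
        (commutator (twistedSubalgebra hbar K)ˣ).map (twistedSubalgebra hbar K).unitsVal := by
    rintro _ ⟨x, hx, rfl⟩
    exact ⟨_, map_mem_commutator (Units.map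
      (Subalgebra.inclusion (twistedSubalgebra_mono hbar h) : _ →* twistedSubalgebra hbar K)) hx,
      rfl⟩
  rw [commutator_eq_closure] at hu
  induction hu using Subgroup.closure_induction with
  | mem x hx =>
    obtain ⟨a, b, rfl⟩ := hx
    -- The supports of the inverses are included so that `a` and `b` become units of the subalgebra,
    -- not merely elements.
    let S : Finset G := (bar.repr a).support ∪ (bar.repr ↑a⁻¹).support ∪
      ((bar.repr b).support ∪ (bar.repr ↑b⁻¹).support)
    let H := Subgroup.closure (S : Set G)
    have hS (c : A) (hc : (bar.repr c).support ⊆ S) : c ∈ twistedSubalgebra hbar H :=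
      (mem_twistedSubalgebra hbar).2
        ((Finset.coe_subset.2 hc).trans Subgroup.subset_closure)
    have lift (c : Aˣ) (hc : (bar.repr c).support ∪ (bar.repr ↑c⁻¹).support ⊆ S) :
        ∃ c' : (twistedSubalgebra hbar H)ˣ, (twistedSubalgebra hbar H).unitsVal c' = c :=
      ⟨⟨⟨c, hS _ (Finset.union_subset_left hc)⟩, ⟨↑c⁻¹, hS _ (Finset.union_subset_right hc)⟩,
        Subtype.ext c.mul_inv, Subtype.ext c.inv_mul⟩, Units.ext rfl⟩
    obtain ⟨a', ha'⟩ := lift a Finset.subset_union_left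
    obtain ⟨b', hb'⟩ := lift b Finset.subset_union_right
    refine ⟨H, ⟨S, rfl⟩, ⁅a', b'⁆, ?_, by rw [map_commutatorElement, ha', hb']⟩
    exact Subgroup.commutator_mem_commutator (Subgroup.mem_top _) (Subgroup.mem_top _)
  | one => exact ⟨⊥, ⟨∅, by simp⟩, one_mem _⟩
  | mul x y _ _ hx hy =>
    obtain ⟨H, hH, hx⟩ := hx
    obtain ⟨K, hK, hy⟩ := hy
    exact ⟨H ⊔ K, hH.sup hK, mul_mem (mono le_sup_left hx) (mono le_sup_right hy)⟩
  | inv x _ hx =>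
    obtain ⟨H, hH, hx⟩ := hx
    exact ⟨H, hH, inv_mem hx⟩

end TwistedBasis

theorem mainTheorem9 {F G A : Type*} [Field F] [CharZero F]
    (hF : IsAlgClosed F ∨ IsRealClosedField F)
    [Group G] (hG : IsLocallyFiniteGroup G)
    [Ring A] [Algebra F A] (τ : G → G → Fˣ) (hA : IsTwistedGroupAlgebra F G A τ) :
    ∀ u ∈ commutator Aˣ, ∃ v w : Aˣ, u = v ^ 2 * w ^ 2 := by
  intro u hu
  obtain ⟨bar, hbar⟩ := hA
  obtain ⟨H, hH, u, hu', rfl⟩ := exists_fg_mem_map_commutator hbar hu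
  have := hG H hH
  have hB := isTwistedGroupAlgebra_twistedSubalgebra hbar H
  have := hB.isSemisimpleRing
  have : Module.Finite F (twistedSubalgebra hbar H) := .of_basis hB.choose
  obtain ⟨v, w, rfl⟩ := CommutatorsAreTwoSquares.of_isSemisimpleRing hF u hu'
  exact ⟨(twistedSubalgebra hbar H).unitsVal v, (twistedSubalgebra hbar H).unitsVal w, by simp⟩
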